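/- For $\beta>1$ let $T_\beta(x)=\beta x-\lfloor \beta x\rfloor$ for $x\in[0,1]$, and let $T_\beta^n$ be its $n$-th iterate. Let $x_0\in[0,1]$ and let $(\ell_n)_{n\ge 1}$ be a sequence of positive integers with $\ell_n\to\infty$ as $n\to\infty$. Put $$\alpha=\liminf_{n\to\infty}\frac{\ell_n}{n}\in[0,\infty].$$ Then the set $$E(\{\ell_n\}_{n\ge1},x_0)=\Big\{\beta>1:\ |T_\beta^n 1-x_0|<\beta^{-\ell_n}\ \text{for infinitely many } n\ge 1\Big\}$$ has Hausdorff dimension $$\dim_{\mathrm H}E(\{\ell_n\}_{n\ge1},x_0)=\frac1{1+\alpha},$$ where the right-hand side is read as $0$ if $\alpha=\infty$. -/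

import Mathlib

open Filter
open scoped ENNReal

/-- The `β`-transformation `T_β x = β x - ⌊β x⌋`. -/
noncomputable def betaMap (β x : ℝ) : ℝ := β * x - (⌊β * x⌋ : ℝ)

/-- The set `E({ℓ_n}, x₀)` of all `β > 1` such that `|T_β^n 1 - x₀| < β^{-ℓ_n}` for infinitely
many positive integers `n`. -/
def approxSet (l : ℕ → ℕ) (x₀ : ℝ) : Set ℝ :=
  {β : ℝ | 1 < β ∧
    {n : ℕ | 1 ≤ n ∧ |(betaMap β)^[n] 1 - x₀| < β ^ (-(l n : ℤ))}.Infinite}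

/-!
Both bounds rest on the cylinders of the parameter space, the sets of `β` whose expansion of `1`
starts with a given digit word of length `n`. On a cylinder `β ↦ T_β^n 1` is an increasing
polynomial, because `T_β^(n+1) 1 = β T_β^n 1 - d` and the orbit is nonnegative; for `a ≤ β ≤ b` its
slope lies between `a ^ (n - 1)` and `n b ^ n`.

*Upper bound.* In `[a, b]` there are at most `(n + 1) b ^ n` cylinders of order `n`: words are
ranked in the numeration system whose place values come from the expansion of `1` in base `b`
(`wordRank_betaDigit_lt`, `betaDigit_eq_of_wordRank_eq`, `placeValue_betaDigit_le`), and every tail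
of an expansion of `1` in a smaller base is lexicographically dominated by that expansion. Each
cylinder contributes a set of diameter `O(a ^ (-(n + l n)))` to the solutions at time `n`. When
`l n ≥ A n` eventually and `s (1 + A) > 1`, the `s`-th powers of these diameters are summable as soon
as `b < a ^ (s (1 + A))`; countably many such `[a, b]` cover `(1, ∞)` (`dimH_approxSet_le`).

*Lower bound.* Every interval of length `(n + 1) a ^ (-(n - 1))` contains a full cylinder of order
`n`, one which `β ↦ T_β^n 1` maps onto `[0, 1)` (`exists_isFullCylinder`). Indeed, move right from
any parameter until one of the branches of order at most `n` reaches `1`; at that moment the orbit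
hits `0`, at a time `m ≤ n`. Starting from there, the next such moment either ends a full cylinder
of order `n`, or has a strictly smaller time, so at most `n` further moves are needed. A full
cylinder contains solutions for any target `x₀`, in an interval of length about `b ^ (-(n + l n))`.
A Cantor set built along sparse times `n` with `l n ≤ B n` then has dimension at least `s` whenever
`s (1 + B) < 1` (`le_dimH_of_forall_exists_Icc_subset`), since a Hölder map of exponent `s` sends it
onto `[0, 1)`; here `[a, b]` is taken so short that `b ^ (s (1 + B)) < a`.
-/

/-! ### The orbit of `1` and its digits -/

/-- The `n`-th point `T_β^n 1` of the orbit of `1` under the `β`-transformation. -/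
noncomputable def betaOrbit (β : ℝ) (n : ℕ) : ℝ := (betaMap β)^[n] 1

/-- The digit `⌊β T_β^n 1⌋` of the `β`-expansion of `1`, indexed from `n = 0`. The natural-number
floor agrees with the integer floor of `betaMap` because the orbit is nonnegative. -/
noncomputable def betaDigit (β : ℝ) (n : ℕ) : ℕ := ⌊β * betaOrbit β n⌋₊

@[simp] lemma betaOrbit_zero (β : ℝ) : betaOrbit β 0 = 1 := rfl

lemma betaOrbit_succ_eq_fract (β : ℝ) (n : ℕ) :
    betaOrbit β (n + 1) = Int.fract (β * betaOrbit β n) := by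
  simp only [betaOrbit, Function.iterate_succ_apply', betaMap, Int.fract]

lemma betaOrbit_nonneg (β : ℝ) (n : ℕ) : 0 ≤ betaOrbit β n := by
  cases n with
  | zero => simp
  | succ n => rw [betaOrbit_succ_eq_fract]; exact Int.fract_nonneg _

lemma betaOrbit_succ_lt_one (β : ℝ) (n : ℕ) : betaOrbit β (n + 1) < 1 := by
  rw [betaOrbit_succ_eq_fract]; exact Int.fract_lt_one _

lemma betaOrbit_le_one (β : ℝ) (n : ℕ) : betaOrbit β n ≤ 1 := by
  cases n with
  | zero => simp
  | succ n => exact (betaOrbit_succ_lt_one β n).le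

lemma betaOrbit_succ {β : ℝ} (hβ : 0 ≤ β) (n : ℕ) :
    betaOrbit β (n + 1) = β * betaOrbit β n - betaDigit β n := by
  rw [betaOrbit_succ_eq_fract, Int.fract, betaDigit,
    natCast_floor_eq_intCast_floor (mul_nonneg hβ (betaOrbit_nonneg β n))]

lemma betaOrbit_eq_zero_of_le {β : ℝ} {m n : ℕ} (hmn : m ≤ n) (h : betaOrbit β m = 0) :
    betaOrbit β n = 0 := by
  induction n, hmn using Nat.le_induction with
  | base => exact h
  | succ n _ ih => rw [betaOrbit_succ_eq_fract, ih]; simp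

lemma betaOrbit_add_sum {β : ℝ} (hβ : 0 ≤ β) (n : ℕ) :
    betaOrbit β n + ∑ i ∈ Finset.range n, (betaDigit β i : ℝ) * β ^ (n - 1 - i) = β ^ n := by
  induction n with
  | zero => simp
  | succ n ih =>
    rw [Finset.sum_range_succ, betaOrbit_succ hβ, pow_succ, ← ih, add_mul, Finset.sum_mul]
    have : ∀ i ∈ Finset.range n, (betaDigit β i : ℝ) * β ^ (n + 1 - 1 - i)
        = (betaDigit β i : ℝ) * β ^ (n - 1 - i) * β := by
      intro i hi
      rw [Finset.mem_range] at hi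
      rw [show n + 1 - 1 - i = (n - 1 - i) + 1 by omega, pow_succ]; ring
    rw [Finset.sum_congr rfl this]
    simp
    ring

/-- On parameters sharing the first `n + 1` digits, `β ↦ T_β^(n+1) 1` has slope at least `a ^ n`. -/
lemma pow_mul_sub_le_betaOrbit_sub {a β β' : ℝ} (ha : 0 ≤ a) (haβ : a ≤ β) (hββ' : β ≤ β') (n : ℕ)
    (hd : ∀ k ≤ n, betaDigit β k = betaDigit β' k) :
    a ^ n * (β' - β) ≤ betaOrbit β' (n + 1) - betaOrbit β (n + 1) := by
  have hβ : 0 ≤ β := ha.trans haβ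
  have hβ' : 0 ≤ β' := hβ.trans hββ'
  induction n with
  | zero =>
    rw [betaOrbit_succ hβ, betaOrbit_succ hβ', hd 0 le_rfl]; simp
  | succ n ih =>
    have ih := ih fun k hk => hd k (by omega)
    rw [betaOrbit_succ hβ (n + 1), betaOrbit_succ hβ' (n + 1), hd (n + 1) le_rfl]
    have h1 : a * (a ^ n * (β' - β)) ≤ β' * (betaOrbit β' (n + 1) - betaOrbit β (n + 1)) :=
      mul_le_mul (haβ.trans hββ') ih
        (mul_nonneg (pow_nonneg ha n) (by linarith)) hβ'
    have h2 : 0 ≤ (β' - β) * betaOrbit β (n + 1) :=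
      mul_nonneg (by linarith) (betaOrbit_nonneg _ _)
    rw [pow_succ]
    nlinarith

/-- As long as a tail of the expansion of `1` in base `β ≤ b` agrees with the expansion of `1` in
base `b`, its orbit stays below that of `b`. -/
lemma betaOrbit_add_le {β b : ℝ} (hβ : 0 ≤ β) (hb : β ≤ b) (m k : ℕ)
    (h : ∀ i < k, betaDigit β (m + i) = betaDigit b i) : betaOrbit β (m + k) ≤ betaOrbit b k := by
  induction k with
  | zero => simpa using betaOrbit_le_one β m
  | succ k ih =>
    have ih := ih fun i hi => h i (by omega)
    rw [← add_assoc, betaOrbit_succ hβ, betaOrbit_succ (hβ.trans hb), h k (by omega)]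
    have := mul_le_mul hb ih (betaOrbit_nonneg _ _) (hβ.trans hb)
    linarith

/-- The lexicographic domination of every tail of the expansion of `1` in base `β` by the
expansion of `1` in a larger base. -/
lemma betaDigit_add_le {β b : ℝ} (hβ : 0 ≤ β) (hb : β ≤ b) (m k : ℕ)
    (h : ∀ i < k, betaDigit β (m + i) = betaDigit b i) : betaDigit β (m + k) ≤ betaDigit b k :=
  Nat.floor_mono (mul_le_mul hb (betaOrbit_add_le hβ hb m k h) (betaOrbit_nonneg _ _)
    (hβ.trans hb))

/-! ### Counting digit words -/

/-- The place values of the numeration system attached to a digit sequence `e`. When `e` is the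
expansion of `1` in base `b`, `placeValue e n` bounds the number of words of length `n` occurring
in expansions of `1` in bases at most `b`. -/
def placeValue (e : ℕ → ℕ) (n : ℕ) : ℕ :=
  1 + ∑ i : Fin n, e i * placeValue e (n - 1 - i)
termination_by n
decreasing_by omega

lemma placeValue_eq (e : ℕ → ℕ) (n : ℕ) :
    placeValue e n = 1 + ∑ i ∈ Finset.range n, e i * placeValue e (n - 1 - i) := by
  rw [placeValue, Finset.sum_range fun i => e i * placeValue e (n - 1 - i)]

/-- The value of the word `d 0, …, d (n - 1)` in the numeration system attached to `e`. -/
def wordRank (e d : ℕ → ℕ) (n : ℕ) : ℕ := ∑ i ∈ Finset.range n, d i * placeValue e (n - 1 - i)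

lemma wordRank_add (e d : ℕ → ℕ) (j r : ℕ) :
    wordRank e d (j + 1 + r) = ∑ i ∈ Finset.range j, d i * placeValue e (j + 1 + r - 1 - i)
      + d j * placeValue e r + wordRank e (fun i => d (j + 1 + i)) r := by
  rw [wordRank, wordRank, Finset.sum_range_add, Finset.sum_range_succ]
  have h1 : j + 1 + r - 1 - j = r := by omega
  have h2 : ∀ i, j + 1 + r - 1 - (j + 1 + i) = r - 1 - i := fun i => by omega
  simp only [h1, h2]

/-- A word all of whose tails are lexicographically dominated by `e` has value below the next
place value. -/
lemma wordRank_lt {e : ℕ → ℕ} (n : ℕ) : ∀ d : ℕ → ℕ,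
    (∀ m k, (∀ i < k, d (m + i) = e i) → d (m + k) ≤ e k) → wordRank e d n < placeValue e n := by
  induction n using Nat.strong_induction_on with
  | _ n ih =>
  intro d hd
  by_cases h : ∀ i < n, d i = e i
  · have h1 : wordRank e d n = wordRank e e n :=
      Finset.sum_congr rfl fun i hi => by rw [h i (Finset.mem_range.1 hi)]
    have h2 : placeValue e n = 1 + wordRank e e n := placeValue_eq _ _
    omega
  · classical
    push Not at h
    let j := Nat.find h
    obtain ⟨hjn, hj⟩ : j < n ∧ d j ≠ e j := Nat.find_spec h
    have hlt : ∀ i < j, d i = e i := fun i hi => by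
      by_contra hne
      exact Nat.find_min h hi ⟨hi.trans hjn, hne⟩
    have hle : d j ≤ e j := by simpa using hd 0 j (by simpa using hlt)
    have hdj : d j + 1 ≤ e j := by omega
    clear_value j
    obtain ⟨r, rfl⟩ : ∃ r, n = j + 1 + r := ⟨n - (j + 1), by omega⟩
    have htail := ih r (by omega) (fun i => d (j + 1 + i)) fun m k hk => by
      simpa [add_assoc] using hd (j + 1 + m) k (by simpa [add_assoc] using hk)
    have h1 := wordRank_add e d j r
    have h2 : placeValue e (j + 1 + r) = 1 + wordRank e e (j + 1 + r) := placeValue_eq _ _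
    have h3 := wordRank_add e e j r
    have h4 : ∑ i ∈ Finset.range j, d i * placeValue e (j + 1 + r - 1 - i)
        = ∑ i ∈ Finset.range j, e i * placeValue e (j + 1 + r - 1 - i) :=
      Finset.sum_congr rfl fun i hi => by rw [hlt i (Finset.mem_range.1 hi)]
    have h5 := Nat.mul_le_mul_right (placeValue e r) hdj
    rw [add_mul, one_mul] at h5
    omega

lemma wordRank_betaDigit_lt {β b : ℝ} (hβ : 0 ≤ β) (hb : β ≤ b) (n : ℕ) :
    wordRank (betaDigit b) (betaDigit β) n < placeValue (betaDigit b) n :=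
  wordRank_lt n _ (betaDigit_add_le hβ hb)

/-- The value of the digit word determines the word. -/
lemma betaDigit_eq_of_wordRank_eq {β β' b : ℝ} (hβ : 0 ≤ β) (hββ' : β ≤ β') (hb : β' ≤ b) {n : ℕ}
    (h : wordRank (betaDigit b) (betaDigit β) n = wordRank (betaDigit b) (betaDigit β') n) :
    ∀ i < n, betaDigit β i = betaDigit β' i := by
  classical
  by_contra hne
  push Not at hne
  let j := Nat.find hne
  obtain ⟨hjn, hj⟩ : j < n ∧ betaDigit β j ≠ betaDigit β' j := Nat.find_spec hne
  have hlt : ∀ i < j, betaDigit β i = betaDigit β' i := fun i hi => by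
    by_contra hne'
    exact Nat.find_min hne hi ⟨hi.trans hjn, hne'⟩
  have hle : betaDigit β j ≤ betaDigit β' j := by
    simpa using betaDigit_add_le hβ hββ' 0 j (by simpa using hlt)
  have hdj : betaDigit β j + 1 ≤ betaDigit β' j := by omega
  clear_value j
  obtain ⟨r, rfl⟩ : ∃ r, n = j + 1 + r := ⟨n - (j + 1), by omega⟩
  rw [wordRank_add, wordRank_add,
    Finset.sum_congr rfl fun i hi => by rw [hlt i (Finset.mem_range.1 hi)]] at h
  have htail := wordRank_lt (e := betaDigit b) r (fun i => betaDigit β (j + 1 + i))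
    fun m k hk => by
      simpa [add_assoc] using
        betaDigit_add_le hβ (hββ'.trans hb) (j + 1 + m) k (by simpa [add_assoc] using hk)
  have h5 := Nat.mul_le_mul_right (placeValue (betaDigit b) r) hdj
  rw [add_mul, one_mul] at h5
  omega

lemma placeValue_betaDigit_le {b : ℝ} (hb : 1 ≤ b) (n : ℕ) :
    (placeValue (betaDigit b) n : ℝ) ≤ (n + 1) * b ^ n := by
  have hb0 : 0 ≤ b := by linarith
  induction n using Nat.strong_induction_on with
  | _ n ih =>
  rw [placeValue_eq]
  push_cast
  have h1 : ∑ i ∈ Finset.range n, (betaDigit b i : ℝ) * placeValue (betaDigit b) (n - 1 - i)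
      ≤ ∑ i ∈ Finset.range n, n * ((betaDigit b i : ℝ) * b ^ (n - 1 - i)) := by
    refine Finset.sum_le_sum fun i hi => ?_
    rw [Finset.mem_range] at hi
    have h2 : (placeValue (betaDigit b) (n - 1 - i) : ℝ) ≤ n * b ^ (n - 1 - i) := by
      refine (ih (n - 1 - i) (by omega)).trans ?_
      gcongr
      have : n - 1 - i + 1 ≤ n := by omega
      exact_mod_cast this
    calc _ ≤ (betaDigit b i : ℝ) * (n * b ^ (n - 1 - i)) := by gcongr
      _ = _ := by ring
  rw [← Finset.mul_sum] at h1
  have h3 := betaOrbit_add_sum hb0 n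
  have h4 : (n : ℝ) * ∑ i ∈ Finset.range n, (betaDigit b i : ℝ) * b ^ (n - 1 - i) ≤ n * b ^ n := by
    gcongr
    linarith [betaOrbit_nonneg b n]
  have h5 : 1 ≤ b ^ n := one_le_pow₀ hb
  linarith

/-! ### The upper bound -/

/-- The parameters in `[a, b]` whose expansion of `1` starts with the digit word of value `r`, and
for which `T_β^n 1` is close to `x₀`. -/
def approxCylinder (l : ℕ → ℕ) (x₀ a b : ℝ) (n r : ℕ) : Set ℝ :=
  {β | β ∈ Set.Icc a b ∧ |betaOrbit β n - x₀| < β ^ (-(l n : ℤ)) ∧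
    wordRank (betaDigit b) (betaDigit β) n = r}

lemma ediam_approxCylinder_le {l : ℕ → ℕ} {x₀ a b : ℝ} (ha : 1 < a) (n r : ℕ) :
    Metric.ediam (approxCylinder l x₀ a b (n + 1) r) ≤
      ENNReal.ofReal (2 * a ^ (-((l (n + 1) + n : ℕ) : ℤ))) := by
  have ha0 : 0 < a := by linarith
  have key : ∀ β ∈ approxCylinder l x₀ a b (n + 1) r, ∀ β' ∈ approxCylinder l x₀ a b (n + 1) r,
      β ≤ β' → β' - β ≤ 2 * a ^ (-((l (n + 1) + n : ℕ) : ℤ)) := by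
    rintro β ⟨⟨hβa, hβb⟩, hβ, hr⟩ β' ⟨⟨hβa', hβb'⟩, hβ', hr'⟩ hle
    have hpow : ∀ x : ℝ, a ≤ x → x ^ (-(l (n + 1) : ℤ)) ≤ a ^ (-(l (n + 1) : ℤ)) := by
      intro x hx
      rw [zpow_neg, zpow_neg, zpow_natCast, zpow_natCast]
      gcongr
    have hdig := betaDigit_eq_of_wordRank_eq (ha0.le.trans hβa) hle hβb' (hr.trans hr'.symm)
    have h1 := pow_mul_sub_le_betaOrbit_sub ha0.le hβa hle n fun k hk => hdig k (by omega)
    have h2 := abs_lt.1 hβ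
    have h3 := abs_lt.1 hβ'
    have h4 := hpow β hβa
    have h5 := hpow β' hβa'
    have h6 : a ^ (-((l (n + 1) + n : ℕ) : ℤ)) = a ^ (-(l (n + 1) : ℤ)) / a ^ n := by
      rw [Nat.cast_add, neg_add, zpow_add₀ ha0.ne', zpow_neg a (n : ℤ), zpow_natCast, div_eq_mul_inv]
    rw [h6, ← mul_div_assoc, le_div_iff₀ (by positivity)]
    linarith
  refine Metric.ediam_le fun β hβ β' hβ' => ?_
  rw [edist_dist, Real.dist_eq]
  refine ENNReal.ofReal_le_ofReal ?_
  rcases le_total β β' with h | h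
  · rw [abs_sub_comm, abs_of_nonneg (by linarith)]
    exact key β hβ β' hβ' h
  · rw [abs_of_nonneg (by linarith)]
    exact key β' hβ' β hβ h

lemma tsum_ediam_approxCylinder_le {l : ℕ → ℕ} {x₀ a b s : ℝ} (ha : 1 < a) (hab : a ≤ b)
    (hs : 0 < s) (n : ℕ) :
    ∑' r, Metric.ediam (approxCylinder l x₀ a b (n + 1) r) ^ s ≤
      ENNReal.ofReal ((n + 2) * b ^ (n + 1) * (2 * a ^ (-((l (n + 1) + n : ℕ) : ℤ))) ^ s) := by
  have ha0 : 0 < a := by linarith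
  have hD : 0 < 2 * a ^ (-((l (n + 1) + n : ℕ) : ℤ)) := by positivity
  have hsupp : ∀ r ∉ Finset.range (placeValue (betaDigit b) (n + 1)),
      Metric.ediam (approxCylinder l x₀ a b (n + 1) r) ^ s = 0 := by
    intro r hr
    have : approxCylinder l x₀ a b (n + 1) r = ∅ := by
      refine Set.eq_empty_of_forall_notMem ?_
      rintro β ⟨⟨h1, h2⟩, -, h3⟩
      rw [Finset.mem_range, not_lt] at hr
      exact absurd (wordRank_betaDigit_lt (ha0.le.trans h1) h2 (n + 1)) (by omega)
    rw [this, Metric.ediam_empty, ENNReal.zero_rpow_of_pos hs]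
  rw [tsum_eq_sum hsupp]
  calc _ ≤ ∑ _r ∈ Finset.range (placeValue (betaDigit b) (n + 1)),
        ENNReal.ofReal (2 * a ^ (-((l (n + 1) + n : ℕ) : ℤ))) ^ s := by
        gcongr with r hr
        exact ediam_approxCylinder_le ha n r
    _ = ENNReal.ofReal (placeValue (betaDigit b) (n + 1) *
          (2 * a ^ (-((l (n + 1) + n : ℕ) : ℤ))) ^ s) := by
        rw [Finset.sum_const, Finset.card_range, nsmul_eq_mul, ENNReal.ofReal_rpow_of_pos hD,
          ENNReal.ofReal_mul (Nat.cast_nonneg _), ENNReal.ofReal_natCast]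
    _ ≤ _ := by
        refine ENNReal.ofReal_le_ofReal ?_
        have h := placeValue_betaDigit_le (ha.le.trans hab) (n + 1)
        have h' : (placeValue (betaDigit b) (n + 1) : ℝ) ≤ (n + 2) * b ^ (n + 1) := by
          refine h.trans (le_of_eq ?_)
          push_cast; ring
        gcongr

/-- On a parameter interval `[a, b]` short enough for `b < a ^ (s * (1 + A))`, the covers by
cylinders have summable `s`-th powers of diameters. -/
lemma dimH_approxSet_inter_Icc_le {l : ℕ → ℕ} {x₀ a b s A : ℝ} (ha : 1 < a) (hab : a ≤ b)
    (hs : 0 < s) (hb : b < a ^ (s * (1 + A))) (hA : ∀ᶠ n : ℕ in atTop, A * n ≤ l n) :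
    dimH (approxSet l x₀ ∩ Set.Icc a b) ≤ ENNReal.ofReal s := by
  have ha0 : 0 < a := by linarith
  have hb0 : 0 < b := by linarith
  set q : ℝ := b * a ^ (-(s * (1 + A))) with hq
  have hq0 : 0 < q := by positivity
  have hq1 : q < 1 := by
    rw [hq, Real.rpow_neg ha0.le, ← div_eq_mul_inv, div_lt_one (by positivity)]; exact hb
  let w : ℕ → ℝ := fun n => (n + 2) * (2 * a) ^ s * q ^ (n + 1)
  have hw : Summable w := by
    have h1 := summable_pow_mul_geometric_of_norm_lt_one 1
      (show ‖q‖ < 1 by rwa [Real.norm_of_nonneg hq0.le])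
    have h2 := summable_geometric_of_lt_one hq0.le hq1
    refine ((h1.mul_left ((2 * a) ^ s * q)).add (h2.mul_left (2 * (2 * a) ^ s * q))).congr ?_
    intro n
    simp only [w, pow_succ]
    ring
  obtain ⟨N₀, hN₀⟩ := eventually_atTop.1 hA
  have hbound : ∀ n ≥ N₀,
      (n + 2) * b ^ (n + 1) * (2 * a ^ (-((l (n + 1) + n : ℕ) : ℤ))) ^ s ≤ w n := by
    intro n hn
    have h1 := hN₀ (n + 1) (by omega)
    have h2 : (2 * a ^ (-((l (n + 1) + n : ℕ) : ℤ))) ^ s ≤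
        (2 * a) ^ s * (a ^ (-(s * (1 + A)))) ^ (n + 1) := by
      have h3 : a ^ (-((l (n + 1) + n : ℕ) : ℤ)) ≤ a * a ^ (-((1 + A) * (n + 1 : ℕ))) := by
        rw [← Real.rpow_intCast]
        conv_rhs => rw [← Real.rpow_one a, ← Real.rpow_mul ha0.le, ← Real.rpow_add ha0]
        refine Real.rpow_le_rpow_of_exponent_le ha.le ?_
        push_cast at h1 ⊢
        linarith
      calc _ ≤ (2 * (a * a ^ (-((1 + A) * (n + 1 : ℕ))))) ^ s := by gcongr
        _ = _ := by
          rw [← mul_assoc, Real.mul_rpow (by positivity) (by positivity), ← Real.rpow_mul ha0.le,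
            ← Real.rpow_natCast, ← Real.rpow_mul ha0.le]
          congr 2; ring
    calc _ ≤ (n + 2) * b ^ (n + 1) * ((2 * a) ^ s * (a ^ (-(s * (1 + A)))) ^ (n + 1)) := by gcongr
      _ = w n := by simp only [w, hq, mul_pow]; ring
  have hcover : ∀ N : ℕ, approxSet l x₀ ∩ Set.Icc a b ⊆
      ⋃ i : ℕ × ℕ, approxCylinder l x₀ a b (i.1 + N + 1) i.2 := by
    rintro N β ⟨⟨-, hβ⟩, hI⟩
    obtain ⟨n, ⟨-, hn⟩, hNn⟩ := hβ.exists_gt N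
    obtain ⟨m, rfl⟩ : ∃ m, n = m + N + 1 := ⟨n - N - 1, by omega⟩
    exact Set.mem_iUnion.2
      ⟨(m, wordRank (betaDigit b) (betaDigit β) (m + N + 1)), hI, hn, rfl⟩
  have hr : Tendsto (fun N : ℕ => ENNReal.ofReal (2 * (a⁻¹) ^ N)) atTop (nhds 0) := by
    have := (tendsto_pow_atTop_nhds_zero_of_lt_one (inv_nonneg.2 ha0.le)
      (inv_lt_one_of_one_lt₀ ha)).const_mul 2
    simpa using ENNReal.tendsto_ofReal this
  have hdiam : ∀ᶠ N in atTop, ∀ i : ℕ × ℕ,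
      Metric.ediam (approxCylinder l x₀ a b (i.1 + N + 1) i.2) ≤
        ENNReal.ofReal (2 * (a⁻¹) ^ N) := by
    refine Eventually.of_forall fun N i => (ediam_approxCylinder_le ha _ _).trans ?_
    refine ENNReal.ofReal_le_ofReal ?_
    rw [zpow_neg, zpow_natCast, inv_pow]
    gcongr
    · exact ha.le
    · omega
  have hμ := MeasureTheory.Measure.hausdorffMeasure_le_liminf_tsum s
    (approxSet l x₀ ∩ Set.Icc a b) (fun N : ℕ => ENNReal.ofReal (2 * (a⁻¹) ^ N)) hr
    (fun N (i : ℕ × ℕ) => approxCylinder l x₀ a b (i.1 + N + 1) i.2) hdiam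
    (Eventually.of_forall hcover)
  have hlim : Tendsto (fun N : ℕ => ∑' i : ℕ × ℕ,
      Metric.ediam (approxCylinder l x₀ a b (i.1 + N + 1) i.2) ^ s) atTop (nhds 0) := by
    have h0 := ENNReal.tendsto_sum_nat_add (fun n => ENNReal.ofReal (w n))
      (hw.tsum_ofReal_ne_top)
    refine tendsto_of_tendsto_of_tendsto_of_le_of_le' tendsto_const_nhds h0
      (Eventually.of_forall fun _ => zero_le) ?_
    filter_upwards [eventually_ge_atTop N₀] with N hN
    rw [ENNReal.tsum_prod (f := fun n r =>
      Metric.ediam (approxCylinder l x₀ a b (n + N + 1) r) ^ s)]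
    refine ENNReal.tsum_le_tsum fun n => ?_
    exact (tsum_ediam_approxCylinder_le ha hab hs (n + N)).trans
      (ENNReal.ofReal_le_ofReal (hbound _ (by omega)))
  rw [hlim.liminf_eq, nonpos_iff_eq_zero] at hμ
  have := dimH_le_of_hausdorffMeasure_ne_top (d := s.toNNReal)
    (s := approxSet l x₀ ∩ Set.Icc a b)
    (by rw [Real.coe_toNNReal s hs.le, hμ]; exact ENNReal.zero_ne_top)
  exact this

lemma dimH_approxSet_le {l : ℕ → ℕ} {x₀ s A : ℝ} (hs : 0 < s) (hsA : 1 < s * (1 + A))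
    (hA : ∀ᶠ n : ℕ in atTop, A * n ≤ l n) : dimH (approxSet l x₀) ≤ ENNReal.ofReal s := by
  set θ := s * (1 + A) with hθ
  have hsub : approxSet l x₀ ⊆ ⋃ p : {p : ℚ × ℚ // (1 : ℝ) < p.1 ∧ (p.1 : ℝ) ≤ p.2 ∧
      (p.2 : ℝ) < (p.1 : ℝ) ^ θ}, approxSet l x₀ ∩ Set.Icc (p.1.1 : ℝ) (p.1.2 : ℝ) := by
    intro β hβ
    have hβ1 : 1 < β := hβ.1
    -- both endpoints are chosen near `β`, which satisfies `β < β ^ θ`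
    obtain ⟨c, hc1, hc2⟩ := exists_between hsA
    have h1 : β < β ^ c := by
      simpa using Real.rpow_lt_rpow_of_exponent_lt hβ1 hc1
    obtain ⟨b, hb1, hb2⟩ := exists_rat_btwn h1
    have h2 : β ^ (c / θ) < β := by
      have : c / θ < 1 := by rw [div_lt_one (by linarith)]; exact hc2
      simpa using Real.rpow_lt_rpow_of_exponent_lt hβ1 this
    have h3 : 1 < β ^ (c / θ) := Real.one_lt_rpow hβ1 (by apply div_pos <;> linarith)
    obtain ⟨a, ha1, ha2⟩ := exists_rat_btwn h2
    have h4 : β ^ c ≤ (a : ℝ) ^ θ := by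
      have : β ^ c = (β ^ (c / θ)) ^ θ := by
        rw [← Real.rpow_mul (by linarith), div_mul_cancel₀ _ (by linarith)]
      rw [this]
      exact Real.rpow_le_rpow (by linarith) ha1.le (by linarith)
    exact Set.mem_iUnion.2 ⟨⟨(a, b), h3.trans ha1, (ha2.trans hb1).le, hb2.trans_le h4⟩,
      hβ, ha2.le, hb1.le⟩
  refine (dimH_mono hsub).trans ?_
  rw [dimH_iUnion]
  exact iSup_le fun p => dimH_approxSet_inter_Icc_le p.2.1 p.2.2.1 hs p.2.2.2 hA

/-! ### Branches of the orbit and full cylinders -/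

/-- The polynomial in `β` that agrees with `β ↦ T_β^n 1` on the parameters whose expansion of `1`
starts with `d 0, …, d (n - 1)`. -/
def orbitBranch (d : ℕ → ℕ) : ℕ → ℝ → ℝ
  | 0, _ => 1
  | n + 1, β => β * orbitBranch d n β - d n

@[simp] lemma orbitBranch_zero (d : ℕ → ℕ) (β : ℝ) : orbitBranch d 0 β = 1 := rfl

lemma orbitBranch_succ (d : ℕ → ℕ) (n : ℕ) (β : ℝ) :
    orbitBranch d (n + 1) β = β * orbitBranch d n β - d n := rfl

lemma continuous_orbitBranch (d : ℕ → ℕ) (n : ℕ) : Continuous (orbitBranch d n) := by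
  induction n with
  | zero => exact continuous_const
  | succ n ih => exact (continuous_id.mul ih).sub continuous_const

lemma orbitBranch_betaDigit {β : ℝ} (hβ : 0 ≤ β) (n : ℕ) :
    orbitBranch (betaDigit β) n β = betaOrbit β n := by
  induction n with
  | zero => simp
  | succ n ih => rw [orbitBranch_succ, ih, betaOrbit_succ hβ]

/-- The orbit follows a branch as long as the branch takes values in `[0, 1)`. -/
lemma betaOrbit_eq_orbitBranch {d : ℕ → ℕ} {β : ℝ} (n : ℕ)
    (h : ∀ k ≤ n, 1 ≤ k → 0 ≤ orbitBranch d k β ∧ orbitBranch d k β < 1) :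
    betaOrbit β n = orbitBranch d n β := by
  induction n with
  | zero => simp
  | succ n ih =>
    have hn := h (n + 1) le_rfl (by omega)
    rw [betaOrbit_succ_eq_fract, ih fun k hk => h k (by omega), Int.fract_eq_iff]
    refine ⟨hn.1, hn.2, d n, ?_⟩
    rw [orbitBranch_succ]; push_cast; ring

lemma orbitBranch_le_orbitBranch {d : ℕ → ℕ} {x y : ℝ} (hx : 0 ≤ x) (hxy : x ≤ y) (n : ℕ)
    (h : ∀ k < n, 0 ≤ orbitBranch d k x) : orbitBranch d n x ≤ orbitBranch d n y := by
  induction n with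
  | zero => simp
  | succ n ih =>
    have := mul_le_mul hxy (ih fun k hk => h k (by omega)) (h n (by omega)) (hx.trans hxy)
    rw [orbitBranch_succ, orbitBranch_succ]
    linarith

lemma pow_mul_sub_le_orbitBranch_sub {d : ℕ → ℕ} {a x y : ℝ} (ha : 0 ≤ a) (hax : a ≤ x)
    (hxy : x ≤ y) (n : ℕ) (h : ∀ k ≤ n, 0 ≤ orbitBranch d k x) :
    a ^ n * (y - x) ≤ orbitBranch d (n + 1) y - orbitBranch d (n + 1) x := by
  have hx : 0 ≤ x := ha.trans hax
  induction n with
  | zero => simp [orbitBranch_succ]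
  | succ n ih =>
    have ih := ih fun k hk => h k (by omega)
    rw [orbitBranch_succ d (n + 1), orbitBranch_succ d (n + 1)]
    have h1 : a * (a ^ n * (y - x)) ≤ y * (orbitBranch d (n + 1) y - orbitBranch d (n + 1) x) :=
      mul_le_mul (hax.trans hxy) ih (mul_nonneg (pow_nonneg ha n) (by linarith)) (hx.trans hxy)
    have h2 : 0 ≤ (y - x) * orbitBranch d (n + 1) x :=
      mul_nonneg (by linarith) (h _ le_rfl)
    rw [pow_succ]
    nlinarith

lemma orbitBranch_sub_le {d : ℕ → ℕ} {b x y : ℝ} (hb : 1 ≤ b) (hx : 0 ≤ x) (hxy : x ≤ y)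
    (hyb : y ≤ b) (n : ℕ) (h0 : ∀ k ≤ n, 0 ≤ orbitBranch d k x)
    (h1 : ∀ k ≤ n, orbitBranch d k x ≤ 1) :
    orbitBranch d n y - orbitBranch d n x ≤ n * b ^ n * (y - x) := by
  induction n with
  | zero => simp
  | succ n ih =>
    have ih := ih (fun k hk => h0 k (by omega)) fun k hk => h1 k (by omega)
    have hmono := orbitBranch_le_orbitBranch hx hxy n fun k hk => h0 k (by omega)
    have e : orbitBranch d (n + 1) y - orbitBranch d (n + 1) x =
        y * (orbitBranch d n y - orbitBranch d n x) + (y - x) * orbitBranch d n x := by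
      rw [orbitBranch_succ, orbitBranch_succ]; ring
    have e1 : y * (orbitBranch d n y - orbitBranch d n x) ≤ b * (n * b ^ n * (y - x)) :=
      mul_le_mul hyb ih (by linarith) (by linarith)
    have e2 : (y - x) * orbitBranch d n x ≤ (y - x) * b ^ (n + 1) :=
      mul_le_mul_of_nonneg_left ((h1 n (by omega)).trans (one_le_pow₀ hb)) (by linarith)
    rw [e]
    push_cast
    rw [pow_succ] at e2 ⊢
    linarith

/-- Moving the parameter to the right from `β₀`, some branch of order at most `n + 1` reaches `1`,
at a parameter `β₁` within distance `a ^ (-n)`; until then all the digits up to order `n + 1` stay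
constant. The index `m` is the smallest order for which this happens. -/
lemma exists_orbitBranch_eq_one {a β₀ : ℝ} (ha : 1 < a) (haβ : a ≤ β₀) (n : ℕ) :
    ∃ β₁ m, β₀ < β₁ ∧ β₁ ≤ β₀ + (a ^ n)⁻¹ ∧ 1 ≤ m ∧ m ≤ n + 1 ∧
      (∀ β ∈ Set.Ico β₀ β₁, betaOrbit β (n + 1) = orbitBranch (betaDigit β₀) (n + 1) β) ∧
      (∀ k ≤ n + 1, orbitBranch (betaDigit β₀) k β₁ ≤ 1) ∧
      orbitBranch (betaDigit β₀) m β₁ = 1 ∧ betaOrbit β₁ m = 0 := by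
  have ha0 : 0 < a := by linarith
  have hβ₀ : 0 ≤ β₀ := by linarith
  set d := betaDigit β₀ with hd
  have hd0 : ∀ k, 0 ≤ orbitBranch d k β₀ := fun k => by
    rw [hd, orbitBranch_betaDigit hβ₀]; exact betaOrbit_nonneg _ _
  have hd1 : ∀ k, 1 ≤ k → orbitBranch d k β₀ < 1 := fun k hk => by
    obtain ⟨k, rfl⟩ : ∃ j, k = j + 1 := ⟨k - 1, by omega⟩
    rw [hd, orbitBranch_betaDigit hβ₀]; exact betaOrbit_succ_lt_one _ _
  have hpos : ∀ k β, β₀ ≤ β → 0 ≤ orbitBranch d k β := fun k β hβ =>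
    (hd0 k).trans (orbitBranch_le_orbitBranch hβ₀ hβ k fun j _ => hd0 j)
  let S : Set ℝ := Set.Icc β₀ (β₀ + (a ^ n)⁻¹) ∩
    ⋃ k ∈ Finset.Icc 1 (n + 1), {β | 1 ≤ orbitBranch d k β}
  have hSc : IsClosed S := isClosed_Icc.inter (isClosed_biUnion_finset fun k _ =>
    isClosed_le continuous_const (continuous_orbitBranch d k))
  have hend : β₀ ≤ β₀ + (a ^ n)⁻¹ := by
    have : 0 ≤ (a ^ n)⁻¹ := by positivity
    linarith
  have hSne : S.Nonempty := by
    refine ⟨β₀ + (a ^ n)⁻¹, ⟨hend, le_rfl⟩, ?_⟩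
    simp only [Set.mem_iUnion, Finset.mem_Icc, Set.mem_ofPred_eq]
    refine ⟨n + 1, ⟨by omega, le_rfl⟩, ?_⟩
    have h := pow_mul_sub_le_orbitBranch_sub ha0.le haβ hend n fun k _ => hd0 k
    rw [add_sub_cancel_left, mul_inv_cancel₀ (by positivity)] at h
    linarith [hd0 (n + 1)]
  have hSb : BddBelow S := ⟨β₀, fun β hβ => hβ.1.1⟩
  have hmem := hSc.csInf_mem hSne hSb
  set β₁ := sInf S with hβ₁
  have hmin : ∀ β ∈ Set.Ico β₀ β₁, ∀ k, 1 ≤ k → k ≤ n + 1 → orbitBranch d k β < 1 := by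
    intro β hβ k hk1 hk2
    by_contra hge
    rw [not_lt] at hge
    have : β ∈ S := by
      refine ⟨⟨hβ.1, hβ.2.le.trans hmem.1.2⟩, ?_⟩
      simp only [Set.mem_iUnion, Finset.mem_Icc, Set.mem_ofPred_eq]
      exact ⟨k, ⟨hk1, hk2⟩, hge⟩
    exact absurd (csInf_le hSb this) (not_le.2 hβ.2)
  obtain ⟨⟨h1, h2⟩, h3⟩ := hmem
  simp only [Set.mem_iUnion, Finset.mem_Icc, Set.mem_ofPred_eq, exists_prop] at h3
  have hle : ∀ k ≤ n + 1, orbitBranch d k β₁ ≤ 1 := by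
    intro k hk
    rcases Nat.eq_zero_or_pos k with rfl | hk1
    · simp
    by_contra hgt
    rw [not_le] at hgt
    obtain ⟨z, hz, hz1⟩ := intermediate_value_Icc h1 (continuous_orbitBranch d k).continuousOn
      ⟨(hd1 k hk1).le, hgt.le⟩
    rcases hz.2.eq_or_lt with rfl | hlt
    · linarith
    · exact absurd hz1 (hmin z ⟨hz.1, hlt⟩ k hk1 hk).ne
  classical
  obtain ⟨⟨hm1, hmn⟩, hm⟩ := Nat.find_spec h3
  have hmfind : ∀ k, 1 ≤ k → k < Nat.find h3 → orbitBranch d k β₁ < 1 := by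
    intro k hk hkm
    by_contra hge
    exact Nat.find_min h3 hkm ⟨⟨hk, hkm.le.trans hmn⟩, not_lt.1 hge⟩
  set m := Nat.find h3
  clear_value m
  have hlt : β₀ < β₁ := by
    refine h1.lt_of_ne fun he => ?_
    rw [← he] at hm
    exact absurd hm (not_le.2 (hd1 m hm1))
  have hm' : orbitBranch d m β₁ = 1 := le_antisymm (hle m hmn) hm
  refine ⟨β₁, m, hlt, h2, hm1, hmn, ?_, hle, hm', ?_⟩
  · intro β hβ
    exact betaOrbit_eq_orbitBranch (n + 1) fun k hk hk1 => ⟨hpos k β hβ.1, hmin β hβ k hk1 hk⟩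
  · obtain ⟨j, rfl⟩ : ∃ j, m = j + 1 := ⟨m - 1, by omega⟩
    rw [betaOrbit_succ_eq_fract, betaOrbit_eq_orbitBranch (d := d) j fun k hk hk1 =>
      ⟨hpos k β₁ h1, hmfind k hk1 (by omega)⟩]
    rw [orbitBranch_succ] at hm'
    have : β₁ * orbitBranch d j β₁ = ((1 + d j : ℤ) : ℝ) := by push_cast; linarith
    rw [this, Int.fract_intCast]

/-- `[u, v)` is a full cylinder of order `n` with digits `d`: on it `β ↦ T_β^n 1` follows the
branch given by `d`, which increases from `0` to `1`. -/
structure IsFullCylinder (d : ℕ → ℕ) (n : ℕ) (u v : ℝ) : Prop where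
  lt : u < v
  eq : ∀ β ∈ Set.Ico u v, betaOrbit β n = orbitBranch d n β
  nonneg : ∀ k, 0 ≤ orbitBranch d k u
  le_one : ∀ k ≤ n, orbitBranch d k v ≤ 1
  left : orbitBranch d n u = 0
  right : orbitBranch d n v = 1

/-- If the orbit of `1` hits `0` at time `m ≤ n + 1`, then either the cylinder of order `n + 1`
starting at that parameter is full, or it ends at a parameter whose orbit hits `0` at an earlier
time. -/
lemma exists_isFullCylinder_of_betaOrbit_eq_zero {a : ℝ} (ha : 1 < a) (n m : ℕ) :
    ∀ β₀, a ≤ β₀ → m ≤ n + 1 → betaOrbit β₀ m = 0 →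
      ∃ d u v, β₀ ≤ u ∧ v ≤ β₀ + m * (a ^ n)⁻¹ ∧ IsFullCylinder d (n + 1) u v := by
  induction m using Nat.strong_induction_on with
  | _ m ih =>
  intro β₀ haβ hmn h0
  have hβ₀ : 0 ≤ β₀ := by linarith
  have hinv : 0 < (a ^ n)⁻¹ := inv_pos.2 (pow_pos (by linarith) n)
  have hm : 1 ≤ m := by
    rcases Nat.eq_zero_or_pos m with rfl | h
    · simp at h0
    · exact h
  obtain ⟨β₁, m₁, hlt, hle, hm1, hmn1, heq, hle1, hone, hzero⟩ :=
    exists_orbitBranch_eq_one ha haβ n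
  have hstep : (m₁ : ℝ) * (a ^ n)⁻¹ + (a ^ n)⁻¹ ≤ m * (a ^ n)⁻¹ ∨ m₁ = n + 1 := by
    by_cases hmm : m₁ < m
    · left
      have : (m₁ : ℝ) + 1 ≤ m := by exact_mod_cast hmm
      nlinarith
    · right
      by_contra hne
      -- from order `m` on the branch digits vanish, so the branch of order `m₁ + 1` exceeds `1`
      have hd : betaDigit β₀ m₁ = 0 := by
        rw [betaDigit, betaOrbit_eq_zero_of_le (not_lt.1 hmm) h0]; simp
      have := hle1 (m₁ + 1) (by omega)
      rw [orbitBranch_succ, hone, hd] at this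
      simp at this
      linarith
  rcases hstep with h | rfl
  · have hmm : m₁ < m := by
      have : (m₁ : ℝ) < m := by
        by_contra hge
        nlinarith [mul_le_mul_of_nonneg_right (not_lt.1 hge) hinv.le]
      exact_mod_cast this
    obtain ⟨d, u, v, h1, h2, h3⟩ := ih m₁ hmm β₁ (by linarith) hmn1 hzero
    exact ⟨d, u, v, by linarith, by linarith, h3⟩
  · refine ⟨betaDigit β₀, β₀, β₁, le_rfl, hle.trans ?_, hlt, heq, fun k => ?_, hle1, ?_, hone⟩
    · have : (1 : ℝ) ≤ m := by exact_mod_cast hm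
      nlinarith
    · rw [orbitBranch_betaDigit hβ₀]; exact betaOrbit_nonneg _ _
    · rw [orbitBranch_betaDigit hβ₀]; exact betaOrbit_eq_zero_of_le hmn h0

/-- Full cylinders of order `n + 1` occur in every interval of length `(n + 2) * a ^ (-n)`. -/
lemma exists_isFullCylinder {a p : ℝ} (ha : 1 < a) (hap : a ≤ p) (n : ℕ) :
    ∃ d u v, p ≤ u ∧ v ≤ p + (n + 2) * (a ^ n)⁻¹ ∧ IsFullCylinder d (n + 1) u v := by
  obtain ⟨β₁, m, hlt, hle, -, hmn, -, -, -, hzero⟩ := exists_orbitBranch_eq_one ha hap n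
  obtain ⟨d, u, v, h1, h2, h3⟩ :=
    exists_isFullCylinder_of_betaOrbit_eq_zero ha n m β₁ (by linarith) hmn hzero
  refine ⟨d, u, v, by linarith, ?_, h3⟩
  have hinv : 0 < (a ^ n)⁻¹ := inv_pos.2 (pow_pos (by linarith) n)
  have : (m : ℝ) ≤ n + 1 := by exact_mod_cast hmn
  nlinarith

/-- A full cylinder contains a comparatively long interval of parameters with `T_β^n 1` within
`ε` of a prescribed point. -/
lemma IsFullCylinder.exists_Icc_subset {d : ℕ → ℕ} {n : ℕ} {u v b x₀ ε : ℝ}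
    (h : IsFullCylinder d n u v) (hn : 1 ≤ n) (hu : 0 ≤ u) (hb : 1 ≤ b) (hvb : v ≤ b)
    (hx₀ : x₀ ∈ Set.Icc (0 : ℝ) 1) (hε : 0 < ε) (hε1 : ε ≤ 1) :
    ∃ q, u ≤ q ∧ q + ε / (4 * (n * b ^ n)) ≤ v ∧
      ∀ β ∈ Set.Icc q (q + ε / (4 * (n * b ^ n))), |betaOrbit β n - x₀| < ε := by
  set κ : ℝ := n * b ^ n with hκ
  have hκ0 : 0 < κ := by
    have : (0 : ℝ) < n := by exact_mod_cast hn
    positivity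
  set r := ε / (4 * κ) with hr
  have hr0 : 0 < r := by positivity
  have hκr : 4 * (κ * r) = ε := by rw [hr]; field_simp
  have hnonneg : ∀ x, u ≤ x → ∀ k, 0 ≤ orbitBranch d k x := fun x hx k =>
    (h.nonneg k).trans (orbitBranch_le_orbitBranch hu hx k fun j _ => h.nonneg j)
  have hle1 : ∀ x, u ≤ x → x ≤ v → ∀ k ≤ n, orbitBranch d k x ≤ 1 := fun x hux hxv k hk =>
    (orbitBranch_le_orbitBranch (hu.trans hux) hxv k fun j _ => hnonneg x hux j).trans
      (h.le_one k hk)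
  have hlip : ∀ x y, u ≤ x → x ≤ y → y ≤ v →
      orbitBranch d n y - orbitBranch d n x ≤ κ * (y - x) := fun x y hux hxy hyv =>
    orbitBranch_sub_le hb (hu.trans hux) hxy (hyv.trans hvb) n (fun k _ => hnonneg x hux k)
      (hle1 x hux (hxy.trans hyv))
  have hmono : ∀ x y, u ≤ x → x ≤ y → orbitBranch d n x ≤ orbitBranch d n y := fun x y hux hxy =>
    orbitBranch_le_orbitBranch (hu.trans hux) hxy n fun k _ => hnonneg x hux k
  have hlen : 4 * r ≤ v - u := by
    have h1 := hlip u v le_rfl h.lt.le le_rfl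
    rw [h.left, h.right] at h1
    by_contra hlt
    nlinarith
  obtain ⟨t, ⟨htu, htv⟩, ht⟩ := intermediate_value_Icc h.lt.le
    (continuous_orbitBranch d n).continuousOn
    (show x₀ ∈ Set.Icc (orbitBranch d n u) (orbitBranch d n v) by rwa [h.left, h.right])
  -- the interval is taken on the side of `t` where there is room, away from the excluded end `v`
  rcases le_total t ((u + v) / 2) with hmid | hmid
  · refine ⟨t, htu, by linarith, fun β hβ => ?_⟩
    rw [h.eq β ⟨htu.trans hβ.1, by linarith [hβ.2]⟩, ← ht]
    have h1 := hlip t β htu hβ.1 (by linarith [hβ.2])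
    have h2 := hmono t β htu hβ.1
    rw [abs_of_nonneg (by linarith)]
    nlinarith [hβ.2]
  · refine ⟨t - 2 * r, by linarith, by linarith, fun β hβ => ?_⟩
    have hβ2 : β ≤ t - r := by linarith [hβ.2]
    have huβ : u ≤ β := by linarith [hβ.1]
    rw [h.eq β ⟨huβ, by linarith⟩, ← ht, abs_sub_comm]
    have h1 := hlip β t huβ (by linarith) htv
    have h2 := hmono β t huβ (by linarith)
    rw [abs_of_nonneg (by linarith)]
    nlinarith [hβ.1]

/-- Every parameter interval of length `(n + 2) * a ^ (-n)` contains an interval of length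
comparable to `b ^ (-(n + L))` on which `T_β^(n+1) 1` is within `β ^ (-L)` of `x₀`. -/
lemma exists_Icc_subset_approx {a b p x₀ : ℝ} (ha : 1 < a) (hap : a ≤ p) (n L : ℕ)
    (hpb : p + (n + 2) * (a ^ n)⁻¹ ≤ b) (hx₀ : x₀ ∈ Set.Icc (0 : ℝ) 1) :
    ∃ q, p ≤ q ∧ q + (4 * (n + 1) * b ^ (n + 1 + L))⁻¹ ≤ p + (n + 2) * (a ^ n)⁻¹ ∧
      ∀ β ∈ Set.Icc q (q + (4 * (n + 1) * b ^ (n + 1 + L))⁻¹),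
        |betaOrbit β (n + 1) - x₀| < β ^ (-(L : ℤ)) := by
  have ha0 : 0 < a := by linarith
  have hinv : 0 ≤ (n + 2) * (a ^ n)⁻¹ := by positivity
  have hb : 1 < b := by linarith
  obtain ⟨d, u, v, hpu, hv, hfull⟩ := exists_isFullCylinder ha hap n
  obtain ⟨q, huq, hqv, hq⟩ := hfull.exists_Icc_subset (x₀ := x₀) (ε := (b ^ L)⁻¹) (by omega)
    (by linarith) hb.le (by linarith) hx₀ (by positivity) (inv_le_one_of_one_le₀ (one_le_pow₀ hb.le))
  have e : (b ^ L)⁻¹ / (4 * ((n + 1 : ℕ) * b ^ (n + 1))) = (4 * (n + 1) * b ^ (n + 1 + L))⁻¹ := by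
    rw [div_eq_mul_inv, ← mul_inv, pow_add b (n + 1) L]
    push_cast
    congr 1; ring
  rw [e] at hqv hq
  refine ⟨q, hpu.trans huq, hqv.trans hv, fun β hβ => (hq β hβ).trans_le ?_⟩
  have hβ0 : 0 < β := by linarith [hβ.1]
  have hβb : β ≤ b := by linarith [hβ.2]
  rw [zpow_neg, zpow_natCast]
  gcongr

/-! ### A Cantor construction inside a limsup set -/

/-- The left endpoint of the `j`-th interval of level `k` of a Cantor construction in which every
interval of level `k` has `m k` children. The `i`-th child of an interval starting at `p` is placed
at `q k (p + i * D k)`. -/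
def cantorLeft (p₀ : ℝ) (D : ℕ → ℝ) (q : ℕ → ℝ → ℝ) (m : ℕ → ℕ) : ℕ → ℕ → ℝ
  | 0, _ => p₀
  | k + 1, j => q k (cantorLeft p₀ D q m k (j / m k) + (j % m k : ℕ) * D k)

/-- The limit point of the Cantor construction coded by the digits of `t` in the mixed radix
`m 0, m 1, …`. -/
noncomputable def cantorPoint (p₀ : ℝ) (D : ℕ → ℝ) (q : ℕ → ℝ → ℝ) (m : ℕ → ℕ) (t : ℝ) : ℝ :=
  ⨆ k, cantorLeft p₀ D q m k ⌊t * (∏ i ∈ Finset.range k, m i : ℕ)⌋₊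

/-- The placement `q k p` of intervals of length `L (k + 1)` in blocks of length `D k`, with an
empty second half of the block, used to build a Cantor set in `[p₀, p₀ + L 0]`. -/
structure IsCantorScheme (p₀ : ℝ) (L D : ℕ → ℝ) (q : ℕ → ℝ → ℝ) (m : ℕ → ℕ) : Prop where
  block_pos : ∀ k, 0 < D k
  length_pos : ∀ k, 0 < L k
  two_le : ∀ k, 2 ≤ m k
  children_le : ∀ k, m k * D k ≤ L k
  le_children : ∀ k, L k ≤ 2 * (m k * D k)
  place : ∀ k p, p₀ ≤ p → p + D k ≤ p₀ + L 0 → p ≤ q k p ∧ q k p + L (k + 1) ≤ p + D k / 2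

namespace IsCantorScheme

variable {p₀ : ℝ} {L D : ℕ → ℝ} {q : ℕ → ℝ → ℝ} {m : ℕ → ℕ}

lemma block_le (h : IsCantorScheme p₀ L D q m) (k i : ℕ) (hi : i < m k) :
    i * D k + D k ≤ L k := by
  have h1 : (i : ℝ) + 1 ≤ m k := by exact_mod_cast hi
  nlinarith [h.children_le k, h.block_pos k]

lemma cantorLeft_mem (h : IsCantorScheme p₀ L D q m) (k : ℕ) : ∀ j,
    p₀ ≤ cantorLeft p₀ D q m k j ∧ cantorLeft p₀ D q m k j + L k ≤ p₀ + L 0 := by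
  induction k with
  | zero => intro j; simp [cantorLeft]
  | succ k ih =>
    intro j
    obtain ⟨h1, h2⟩ := ih (j / m k)
    have hi := h.block_le k (j % m k) (Nat.mod_lt _ (by have := h.two_le k; omega))
    have hD := h.block_pos k
    have hiD : 0 ≤ ((j % m k : ℕ) : ℝ) * D k := by positivity
    obtain ⟨h3, h4⟩ := h.place k (cantorLeft p₀ D q m k (j / m k) + (j % m k : ℕ) * D k)
      (by linarith) (by linarith)
    rw [cantorLeft]
    exact ⟨by linarith, by linarith⟩

/-- The interval of level `k + 1` lies in the first half of its block. -/
lemma cantorLeft_succ_mem (h : IsCantorScheme p₀ L D q m) (k j : ℕ) :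
    cantorLeft p₀ D q m k (j / m k) + (j % m k : ℕ) * D k ≤ cantorLeft p₀ D q m (k + 1) j ∧
    cantorLeft p₀ D q m (k + 1) j + L (k + 1) ≤
      cantorLeft p₀ D q m k (j / m k) + (j % m k : ℕ) * D k + D k / 2 := by
  obtain ⟨h1, h2⟩ := h.cantorLeft_mem k (j / m k)
  have hi := h.block_le k (j % m k) (Nat.mod_lt _ (by have := h.two_le k; omega))
  have hD := h.block_pos k
  have hiD : 0 ≤ ((j % m k : ℕ) : ℝ) * D k := by positivity
  exact h.place k _ (by linarith) (by linarith)

lemma floor_div (h : IsCantorScheme p₀ L D q m) (t : ℝ) (k : ℕ) :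
    ⌊t * (∏ i ∈ Finset.range (k + 1), m i : ℕ)⌋₊ / m k =
      ⌊t * (∏ i ∈ Finset.range k, m i : ℕ)⌋₊ := by
  have hm : (m k : ℝ) ≠ 0 := by have := h.two_le k; exact_mod_cast (by omega : m k ≠ 0)
  rw [← Nat.floor_div_natCast, Finset.prod_range_succ]
  congr 1
  push_cast
  field_simp

lemma cantorPoint_mem (h : IsCantorScheme p₀ L D q m) (t : ℝ) (k : ℕ) :
    cantorPoint p₀ D q m t ∈
      Set.Icc (cantorLeft p₀ D q m k ⌊t * (∏ i ∈ Finset.range k, m i : ℕ)⌋₊)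
        (cantorLeft p₀ D q m k ⌊t * (∏ i ∈ Finset.range k, m i : ℕ)⌋₊ + L k) := by
  have hstep := fun k => h.cantorLeft_succ_mem k ⌊t * (∏ i ∈ Finset.range (k + 1), m i : ℕ)⌋₊
  simp only [h.floor_div] at hstep
  have hi := fun k => h.block_le k (⌊t * (∏ i ∈ Finset.range (k + 1), m i : ℕ)⌋₊ % m k)
    (Nat.mod_lt _ (by have := h.two_le k; omega))
  have hmono : Monotone fun k =>
      cantorLeft p₀ D q m k ⌊t * (∏ i ∈ Finset.range k, m i : ℕ)⌋₊ := by
    refine monotone_nat_of_le_succ fun k => le_trans ?_ (hstep k).1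
    have hD := h.block_pos k
    exact le_add_of_nonneg_right (by positivity)
  have hanti : Antitone fun k =>
      cantorLeft p₀ D q m k ⌊t * (∏ i ∈ Finset.range k, m i : ℕ)⌋₊ + L k := by
    refine antitone_nat_of_succ_le fun k => (hstep k).2.trans ?_
    have hD := h.block_pos k
    linarith [hi k]
  exact Set.mem_iInter.1 (hmono.ciSup_mem_iInter_Icc_of_antitone hanti
    fun k => (le_add_of_nonneg_right (h.length_pos k).le)) k

/-- Points coded by distinct `t, t'` separate at some level, which bounds `t' - t` from above and
the distance of the coded points from below. -/
lemma exists_separation (h : IsCantorScheme p₀ L D q m) {t t' : ℝ} (ht : 0 ≤ t) (htt' : t < t')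
    (ht' : t' < 1) :
    ∃ k, ∃ c : ℝ, 1 ≤ c ∧ (t' - t) * (∏ i ∈ Finset.range k, m i : ℕ) ≤ 1 ∧
      (t' - t) * ((∏ i ∈ Finset.range k, m i : ℕ) * m k) ≤ 2 * c ∧
      c * D k / 2 ≤ cantorPoint p₀ D q m t' - cantorPoint p₀ D q m t := by
  classical
  let N : ℕ → ℕ := fun k => ∏ i ∈ Finset.range k, m i
  have hN : ∀ k, 2 ^ k ≤ N k := fun k => by
    simpa using Finset.prod_le_prod' (s := Finset.range k) (f := fun _ => 2) fun i _ => h.two_le i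
  have hex : ∃ k, ⌊t * (N k : ℕ)⌋₊ ≠ ⌊t' * (N k : ℕ)⌋₊ := by
    obtain ⟨k, hk⟩ := pow_unbounded_of_one_lt (t' - t)⁻¹ (by norm_num : (1 : ℝ) < 2)
    refine ⟨k, fun heq => ?_⟩
    have hNk : (t' - t)⁻¹ < N k := hk.trans_le (by exact_mod_cast hN k)
    rw [inv_lt_iff_one_lt_mul₀ (by linarith)] at hNk
    have h1 := Nat.floor_le (mul_nonneg ht (Nat.cast_nonneg (N k)))
    have h2 := Nat.lt_floor_add_one (t' * (N k : ℕ))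
    rw [heq] at h1
    nlinarith
  have hspec := Nat.find_spec hex
  have hfirst := fun k => Nat.find_min (m := k) hex
  set K := Nat.find hex
  clear_value K
  obtain ⟨k, rfl⟩ : ∃ k, K = k + 1 := by
    refine ⟨K - 1, ?_⟩
    rcases Nat.eq_zero_or_pos K with rfl | hK
    · refine absurd ?_ hspec
      simp only [N, Finset.range_zero, Finset.prod_empty, Nat.cast_one, mul_one]
      rw [Nat.floor_eq_zero.2 (htt'.trans ht'), Nat.floor_eq_zero.2 ht']
    · omega
  have heq : ⌊t * (N k : ℕ)⌋₊ = ⌊t' * (N k : ℕ)⌋₊ := not_not.1 (hfirst k (by omega))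
  set i := ⌊t * (N (k + 1) : ℕ)⌋₊ with hi
  set i' := ⌊t' * (N (k + 1) : ℕ)⌋₊ with hi'
  have hlt : i < i' := lt_of_le_of_ne (Nat.floor_mono (by gcongr)) hspec
  have hdiv : i / m k = i' / m k := by
    rw [hi, hi']
    exact (h.floor_div t k).trans (heq.trans (h.floor_div t' k).symm)
  have hNs : ((N (k + 1) : ℕ) : ℝ) = N k * m k := by
    simp only [N, Finset.prod_range_succ]; push_cast; rfl
  have hc1 : (i : ℝ) + 1 ≤ i' := by exact_mod_cast hlt
  refine ⟨k, (i' : ℝ) - i, by linarith, ?_, ?_, ?_⟩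
  · have h1 := Nat.floor_le (mul_nonneg ht (Nat.cast_nonneg (N k)))
    have h2 := Nat.lt_floor_add_one (t' * (N k : ℕ))
    rw [heq] at h1
    change (t' - t) * (N k : ℕ) ≤ 1
    linarith
  · have h1 := Nat.floor_le (mul_nonneg ht (Nat.cast_nonneg (N (k + 1))))
    have h2 := Nat.lt_floor_add_one (t' * (N (k + 1) : ℕ))
    rw [← hi] at h1
    rw [← hi'] at h2
    change (t' - t) * ((N k : ℕ) * m k) ≤ _
    rw [← hNs]
    linarith
  · have h1 := (h.cantorPoint_mem t (k + 1)).2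
    have h2 := (h.cantorPoint_mem t' (k + 1)).1
    have h3 := (h.cantorLeft_succ_mem k i).2
    have h4 := (h.cantorLeft_succ_mem k i').1
    change _ ≤ cantorLeft p₀ D q m (k + 1) i + _ at h1
    change cantorLeft p₀ D q m (k + 1) i' ≤ _ at h2
    rw [hdiv] at h3
    have e : ((i' : ℝ) - i) = ((i' % m k : ℕ) : ℝ) - ((i % m k : ℕ) : ℝ) := by
      have e1 := Nat.div_add_mod i (m k)
      have e2 := Nat.div_add_mod i' (m k)
      rw [hdiv] at e1
      have e1' : (m k : ℝ) * ((i' / m k : ℕ) : ℝ) + ((i % m k : ℕ) : ℝ) = i := by exact_mod_cast e1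
      have e2' : (m k : ℝ) * ((i' / m k : ℕ) : ℝ) + ((i' % m k : ℕ) : ℝ) = i' := by
        exact_mod_cast e2
      linarith
    have hc2 : 1 * D k ≤ ((i' : ℝ) - i) * D k :=
      mul_le_mul_of_nonneg_right (by linarith) (h.block_pos k).le
    rw [e] at hc2 ⊢
    linarith

/-- If the lengths do not shrink too fast compared with the number of intervals, the inverse of the
coding map is Hölder continuous. -/
lemma sub_le_rpow (h : IsCantorScheme p₀ L D q m) {s c₀ : ℝ} (hs0 : 0 < s) (hs1 : s ≤ 1)
    (hc₀ : 0 < c₀) (hL : ∀ k, c₀ ≤ (∏ i ∈ Finset.range k, m i : ℕ) * L k ^ s) {t t' : ℝ}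
    (ht : 0 ≤ t) (htt' : t < t') (ht' : t' < 1) :
    t' - t ≤ c₀⁻¹ * 8 ^ s * (cantorPoint p₀ D q m t' - cantorPoint p₀ D q m t) ^ s := by
  obtain ⟨k, c, hc, h1, h2, h3⟩ := h.exists_separation ht htt' ht'
  have hL := hL k
  set N : ℝ := ((∏ i ∈ Finset.range k, m i : ℕ) : ℝ) with hN
  set X := cantorPoint p₀ D q m t' - cantorPoint p₀ D q m t
  have hLk := h.length_pos k
  have hN0 : 0 < N := by
    by_contra hle
    have := mul_nonpos_of_nonpos_of_nonneg (not_lt.1 hle) (Real.rpow_nonneg hLk.le s)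
    linarith
  have hm : (0 : ℝ) < m k := by have := h.two_le k; exact_mod_cast (by omega : 0 < m k)
  have hδ : 0 < t' - t := by linarith
  have hD := h.block_pos k
  -- `δ N = (δ N)^s (δ N)^(1-s) ≤ (2c / m)^s` for `δ = t' - t`
  have h4 : (t' - t) * N ≤ (2 * c / m k) ^ s := by
    calc (t' - t) * N ≤ ((t' - t) * N) ^ s := by
          simpa using Real.rpow_le_rpow_of_exponent_ge (mul_pos hδ hN0) h1 hs1
      _ ≤ _ := by
          refine Real.rpow_le_rpow (mul_pos hδ hN0).le ?_ hs0.le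
          rw [le_div_iff₀ hm]; linarith
  have h5 : (t' - t) * c₀ ≤ (8 * X) ^ s := by
    calc (t' - t) * c₀ ≤ (t' - t) * (N * L k ^ s) := by gcongr
      _ = (t' - t) * N * L k ^ s := by ring
      _ ≤ (2 * c / m k) ^ s * L k ^ s := by gcongr
      _ = (2 * c / m k * L k) ^ s := by rw [Real.mul_rpow (by positivity) hLk.le]
      _ ≤ (8 * X) ^ s := by
          refine Real.rpow_le_rpow (by positivity) ?_ hs0.le
          have : L k / m k ≤ 2 * D k := by
            rw [div_le_iff₀ hm]; linarith [h.le_children k]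
          calc 2 * c / m k * L k = 2 * c * (L k / m k) := by ring
            _ ≤ 2 * c * (2 * D k) := by gcongr
            _ ≤ _ := by linarith
  have hX : 0 ≤ X := le_trans (by positivity) h3
  rw [Real.mul_rpow (by norm_num) hX] at h5
  rw [mul_assoc, ← div_eq_inv_mul, le_div_iff₀ hc₀]
  exact h5

/-- The Cantor set has dimension at least `s`, because a Hölder map of exponent `s` sends it onto
`[0, 1)`. -/
lemma le_dimH (h : IsCantorScheme p₀ L D q m) {s c₀ : ℝ} (hs0 : 0 < s) (hs1 : s ≤ 1)
    (hc₀ : 0 < c₀) (hL : ∀ k, c₀ ≤ (∏ i ∈ Finset.range k, m i : ℕ) * L k ^ s) :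
    ENNReal.ofReal s ≤ dimH (cantorPoint p₀ D q m '' Set.Ico 0 1) := by
  set x := cantorPoint p₀ D q m with hx
  set C : ℝ := c₀⁻¹ * 8 ^ s with hC
  have hC0 : 0 ≤ C := by positivity
  have hdist : ∀ t ∈ Set.Ico (0 : ℝ) 1, ∀ t' ∈ Set.Ico (0 : ℝ) 1,
      |t - t'| ≤ C * |x t - x t'| ^ s := by
    intro t ht t' ht'
    rcases lt_trichotomy t t' with hlt | rfl | hlt
    · rw [abs_sub_comm, abs_of_pos (by linarith), abs_sub_comm (x t)]
      refine (h.sub_le_rpow hs0 hs1 hc₀ hL ht.1 hlt ht'.2).trans ?_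
      obtain ⟨k, c, hc, -, -, h3⟩ := h.exists_separation ht.1 hlt ht'.2
      have := h.block_pos k
      rw [abs_of_nonneg (le_trans (by positivity) h3)]
    · simp [Real.zero_rpow hs0.ne']
    · rw [abs_of_pos (by linarith)]
      refine (h.sub_le_rpow hs0 hs1 hc₀ hL ht'.1 hlt ht.2).trans ?_
      obtain ⟨k, c, hc, -, -, h3⟩ := h.exists_separation ht'.1 hlt ht.2
      have := h.block_pos k
      rw [abs_of_nonneg (le_trans (by positivity) h3)]
  have hinj : Set.InjOn x (Set.Ico 0 1) := by
    intro t ht t' ht' he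
    have := hdist t ht t' ht'
    rw [he, sub_self, abs_zero, Real.zero_rpow hs0.ne', mul_zero] at this
    exact sub_eq_zero.1 (abs_nonpos_iff.1 this)
  have hleft := hinj.leftInvOn_invFunOn
  set f := Function.invFunOn x (Set.Ico 0 1)
  have himage : f '' (x '' Set.Ico 0 1) = Set.Ico 0 1 := hleft.image_image
  have hholder : HolderOnWith C.toNNReal s.toNNReal f (x '' Set.Ico 0 1) := by
    rintro _ ⟨t, ht, rfl⟩ _ ⟨t', ht', rfl⟩
    rw [hleft ht, hleft ht', edist_dist, edist_dist, Real.dist_eq, Real.dist_eq,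
      Real.coe_toNNReal _ hs0.le, ENNReal.ofReal_rpow_of_nonneg (abs_nonneg _) hs0.le]
    change _ ≤ ENNReal.ofReal C * _
    rw [← ENNReal.ofReal_mul hC0]
    exact ENNReal.ofReal_le_ofReal (hdist t ht t' ht')
  have hs : 0 < s.toNNReal := Real.toNNReal_pos.2 hs0
  have hdim := hholder.dimH_image_le hs
  rw [himage, Real.dimH_of_nonempty_interior (by rw [interior_Ico]; simp)] at hdim
  rw [Module.finrank_self, Nat.cast_one, ENNReal.le_div_iff_mul_le
    (Or.inl (by exact_mod_cast hs.ne')) (Or.inl ENNReal.coe_ne_top), one_mul] at hdim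
  exact hdim

end IsCantorScheme

/-- Lower bound for the dimension of a limsup set: it is at least `s` if at arbitrarily small scales
`D`, every interval of length `D` contains an interval of `G n` of length `r` with `r ^ s` much
larger than `D`. -/
theorem le_dimH_of_forall_exists_Icc_subset {G : ℕ → Set ℝ} {p₀ L₀ s : ℝ} (hL₀ : 0 < L₀)
    (hs0 : 0 < s) (hs1 : s ≤ 1)
    (H : ∀ L : ℝ, 0 < L → ∀ M : ℕ, ∃ n, M ≤ n ∧ ∃ D r : ℝ, 0 < D ∧ 0 < r ∧ r ≤ 1 ∧
      2 * D ≤ L * r ^ s ∧ ∀ p, p₀ ≤ p → p + D ≤ p₀ + L₀ →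
        ∃ q, p ≤ q ∧ q + r ≤ p + D / 2 ∧ Set.Icc q (q + r) ⊆ G n) :
    ENNReal.ofReal s ≤ dimH {x | {n | x ∈ G n}.Infinite} := by
  choose! n hn D r hD hr hr1 hDr q hpq hqr hqG using H
  let L : ℕ → ℝ := fun k => Nat.rec L₀ (fun k Lk => r Lk k) k
  have hL0 : L 0 = L₀ := rfl
  have hLs : ∀ k, L (k + 1) = r (L k) k := fun k => rfl
  have hL : ∀ k, 0 < L k := fun k => by
    induction k with
    | zero => exact hL₀
    | succ k ih => rw [hLs]; exact hr _ ih _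
  let D' : ℕ → ℝ := fun k => D (L k) k
  have hD' : ∀ k, 0 < D' k := fun k => hD _ (hL k) k
  let m : ℕ → ℕ := fun k => ⌊L k / D' k⌋₊
  have hratio : ∀ k, 2 ≤ L k / D' k ∧ 2 ≤ L k / D' k * L (k + 1) ^ s := by
    intro k
    have h1 := hDr _ (hL k) k
    have h2 : r (L k) k ^ s ≤ 1 := Real.rpow_le_one (hr _ (hL k) k).le (hr1 _ (hL k) k) hs0.le
    rw [div_mul_eq_mul_div, le_div_iff₀ (hD' k), le_div_iff₀ (hD' k), hLs]
    exact ⟨h1.trans (mul_le_of_le_one_right (hL k).le h2), h1⟩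
  have hm2 : ∀ k, 2 ≤ m k := fun k => Nat.le_floor (by exact_mod_cast (hratio k).1)
  have hm : ∀ k, L k / D' k ≤ 2 * m k := fun k => by
    have h1 := Nat.lt_floor_add_one (L k / D' k)
    have h2 : (2 : ℝ) ≤ m k := by exact_mod_cast hm2 k
    change _ < (m k : ℝ) + 1 at h1
    linarith
  have hS : IsCantorScheme p₀ L D' (fun k => q (L k) k) m :=
    { block_pos := hD'
      length_pos := hL
      two_le := hm2
      children_le := fun k => by
        have := Nat.floor_le (div_nonneg (hL k).le (hD' k).le)
        rwa [le_div_iff₀ (hD' k)] at this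
      le_children := fun k => by
        have := hm k
        rw [div_le_iff₀ (hD' k)] at this
        linarith
      place := fun k p h1 h2 => ⟨hpq _ (hL k) k p h1 h2, hqr _ (hL k) k p h1 h2⟩ }
  have hN : ∀ k, min 1 (L₀ ^ s) ≤ (∏ i ∈ Finset.range k, m i : ℕ) * L k ^ s := by
    intro k
    cases k with
    | zero => simp [hL0]
    | succ k =>
      refine (min_le_left _ _).trans ?_
      have h1 : (1 : ℝ) ≤ (∏ i ∈ Finset.range k, m i : ℕ) := by
        exact_mod_cast Finset.one_le_prod' fun i _ => (by have := hm2 i; omega : 1 ≤ m i)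
      have h2 : 1 ≤ (m k : ℝ) * L (k + 1) ^ s := by
        have h3 := (hratio k).2
        have h4 := mul_le_mul_of_nonneg_right (hm k) (Real.rpow_nonneg (hL (k + 1)).le s)
        linarith
      rw [Finset.prod_range_succ, Nat.cast_mul, mul_assoc]
      exact one_le_mul_of_one_le_of_one_le h1 h2
  refine (hS.le_dimH hs0 hs1 (lt_min one_pos (Real.rpow_pos_of_pos hL₀ s)) hN).trans
    (dimH_mono ?_)
  rintro _ ⟨t, -, rfl⟩
  refine Nat.frequently_atTop_iff_infinite.1 (frequently_atTop.2 fun k =>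
    ⟨n (L k) k, hn _ (hL k) k, ?_⟩)
  have hmem := hS.cantorPoint_mem t (k + 1)
  set j := ⌊t * (∏ i ∈ Finset.range (k + 1), m i : ℕ)⌋₊
  obtain ⟨h1, h2⟩ := hS.cantorLeft_mem k (j / m k)
  have hi := hS.block_le k (j % m k) (Nat.mod_lt _ (by have := hm2 k; omega))
  have hiD : 0 ≤ ((j % m k : ℕ) : ℝ) * D' k := mul_nonneg (Nat.cast_nonneg _) (hD' k).le
  exact hqG (L k) (hL k) k _ (by linarith) (by change _ + D' k ≤ _; linarith) hmem

/-! ### The lower bound and the dimension formula -/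

lemma tendsto_sq_mul_pow_zero {ρ : ℝ} (h0 : 0 ≤ ρ) (h1 : ρ < 1) (C : ℝ) :
    Tendsto (fun n : ℕ => C * ((n + 2 : ℝ) ^ 2 * ρ ^ n)) atTop (nhds 0) := by
  have t2 := tendsto_pow_const_mul_const_pow_of_lt_one 2 h0 h1
  have t1 := tendsto_pow_const_mul_const_pow_of_lt_one 1 h0 h1
  have t0 := tendsto_pow_atTop_nhds_zero_of_lt_one h0 h1
  have := ((t2.add (t1.const_mul 4)).add (t0.const_mul 4)).const_mul C
  simp only [mul_zero, add_zero] at this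
  refine this.congr fun n => ?_
  ring

lemma le_dimH_approxSet {l : ℕ → ℕ} {x₀ s B : ℝ} (hx₀ : x₀ ∈ Set.Icc (0 : ℝ) 1) (hs0 : 0 < s)
    (hB0 : 0 ≤ B) (hsB : s * (1 + B) < 1) (hB : ∃ᶠ n : ℕ in atTop, (l n : ℝ) ≤ B * n) :
    ENNReal.ofReal s ≤ dimH (approxSet l x₀) := by
  have hs1 : s ≤ 1 := by nlinarith
  -- the construction takes place in `[2, b]` with `b = 2 ^ c`, where `s (1 + B) c < 1`
  obtain ⟨c, hc1, hc2⟩ : ∃ c, 1 < c ∧ s * (1 + B) * c < 1 := by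
    have hθ : 0 < s * (1 + B) := by positivity
    obtain ⟨c, h1, h2⟩ := exists_between ((one_lt_div hθ).2 hsB)
    exact ⟨c, h1, by rwa [lt_div_iff₀ hθ, mul_comm] at h2⟩
  set θ := s * (1 + B) * c with hθ
  set b : ℝ := 2 ^ c with hb
  have hb2 : 2 < b := by simpa using Real.rpow_lt_rpow_of_exponent_lt one_lt_two hc1
  have hb0 : 0 < b := by linarith
  have hρ : (2 : ℝ) ^ (θ - 1) < 1 :=
    Real.rpow_lt_one_of_one_lt_of_neg one_lt_two (by linarith)
  have hlim := tendsto_sq_mul_pow_zero (Real.rpow_nonneg zero_le_two (θ - 1)) hρ (16 * 2 ^ θ)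
  have hB' : ∃ᶠ n : ℕ in atTop, (l (n + 1) : ℝ) ≤ B * (n + 1 : ℕ) := by
    rw [frequently_atTop] at hB ⊢
    intro N
    obtain ⟨n, hn, h⟩ := hB (N + 1)
    obtain ⟨k, rfl⟩ : ∃ k, n = k + 1 := ⟨n - 1, by omega⟩
    exact ⟨k, by omega, h⟩
  have key : ENNReal.ofReal s ≤
      dimH {β | {n | β ∈ {β : ℝ | 2 ≤ β ∧ 1 ≤ n ∧
        |betaOrbit β n - x₀| < β ^ (-(l n : ℤ))}}.Infinite} := by
    refine le_dimH_of_forall_exists_Icc_subset (p₀ := 2) (L₀ := b - 2) (by linarith) hs0 hs1 ?_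
    intro L hL M
    obtain ⟨n, hn, hsmall, hnM⟩ := (hB'.and_eventually
      ((hlim.eventually_le_const hL).and (eventually_ge_atTop M))).exists
    have hpow : (b ^ (n + 1 + l (n + 1))) ^ s ≤ 2 ^ θ * (2 : ℝ) ^ (θ * n) := by
      rw [hb, ← Real.rpow_natCast, ← Real.rpow_mul zero_le_two, ← Real.rpow_mul zero_le_two,
        ← Real.rpow_add two_pos]
      refine Real.rpow_le_rpow_of_exponent_le one_le_two ?_
      push_cast at hn ⊢
      have : c * s * (n + 1 + l (n + 1)) ≤ c * s * (n + 1 + B * (n + 1)) := by gcongr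
      rw [hθ]
      linarith
    have hr0 : (1 : ℝ) ≤ 4 * (n + 1) * b ^ (n + 1 + l (n + 1)) := by
      have h1 : (1 : ℝ) ≤ b ^ (n + 1 + l (n + 1)) := one_le_pow₀ (by linarith)
      have h2 : (1 : ℝ) ≤ 4 * (n + 1) := by
        have : (0 : ℝ) ≤ n := Nat.cast_nonneg n
        linarith
      exact one_le_mul_of_one_le_of_one_le h2 h1
    refine ⟨n + 1, by omega, 2 * ((n + 2) * ((2 : ℝ) ^ n)⁻¹),
      (4 * (n + 1) * b ^ (n + 1 + l (n + 1)))⁻¹, by positivity, by positivity,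
      inv_le_one_of_one_le₀ hr0, ?_, ?_⟩
    · rw [Real.inv_rpow (by positivity), ← div_eq_mul_inv L, le_div_iff₀ (by positivity),
        Real.mul_rpow (by positivity) (by positivity)]
      have h1 : (4 * (n + 1) : ℝ) ^ s ≤ 4 * (n + 2) := by
        calc (4 * (n + 1) : ℝ) ^ s ≤ (4 * (n + 1) : ℝ) ^ (1 : ℝ) := by
              refine Real.rpow_le_rpow_of_exponent_le ?_ hs1
              have : (0 : ℝ) ≤ n := Nat.cast_nonneg n
              linarith
          _ ≤ _ := by rw [Real.rpow_one]; linarith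
      have h2 : ((2 : ℝ) ^ (θ - 1)) ^ n = 2 ^ (θ * n) * ((2 : ℝ) ^ n)⁻¹ := by
        rw [← Real.rpow_natCast, ← Real.rpow_mul zero_le_two, ← Real.rpow_natCast (2 : ℝ) n,
          ← Real.rpow_neg zero_le_two, ← Real.rpow_add two_pos]
        congr 1; ring
      calc _ ≤ 2 * (2 * ((n + 2) * ((2 : ℝ) ^ n)⁻¹)) *
            (4 * (n + 2) * (2 ^ θ * (2 : ℝ) ^ (θ * n))) := by gcongr
        _ = 16 * 2 ^ θ * ((n + 2 : ℝ) ^ 2 * ((2 : ℝ) ^ (θ - 1)) ^ n) := by rw [h2]; ring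
        _ ≤ L := hsmall
    · intro p hp hpb
      have hpos : 0 ≤ (n + 2) * ((2 : ℝ) ^ n)⁻¹ := by positivity
      obtain ⟨q, h1, h2, h3⟩ := exists_Icc_subset_approx (b := b) one_lt_two hp n (l (n + 1))
        (by linarith) hx₀
      exact ⟨q, h1, by linarith, fun β hβ =>
        ⟨by linarith [hβ.1], by omega, h3 β hβ⟩⟩
  refine key.trans (dimH_mono fun β hβ => ?_)
  obtain ⟨n, hn⟩ := Set.Infinite.nonempty hβ
  exact ⟨by linarith [hn.1], Set.Infinite.mono (fun n hn => hn.2) hβ⟩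

theorem theorem1p1 (x₀ : ℝ) (hx₀ : x₀ ∈ Set.Icc (0 : ℝ) 1)
    (l : ℕ → ℕ) (hpos : ∀ n, 1 ≤ n → 0 < l n) (hl : Tendsto l atTop atTop) :
    dimH (approxSet l x₀) =
      1 / (1 + liminf (fun n : ℕ => (l n : ℝ≥0∞) / (n : ℝ≥0∞)) atTop) := by
  set α := liminf (fun n : ℕ => (l n : ℝ≥0∞) / (n : ℝ≥0∞)) atTop with hα
  have hα0 : (1 : ℝ≥0∞) + α ≠ 0 := by simp
  have hdiv : ∀ (n : ℕ) (A : ℝ), 0 < n → 0 ≤ A →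
      (ENNReal.ofReal A ≤ (l n : ℝ≥0∞) / n ↔ A * n ≤ l n) := by
    intro n A hn hA
    rw [ENNReal.le_div_iff_mul_le (Or.inl (by exact_mod_cast hn.ne')) (Or.inl (by simp)),
      ← ENNReal.ofReal_natCast n, ← ENNReal.ofReal_natCast (l n), ← ENNReal.ofReal_mul hA,
      ENNReal.ofReal_le_ofReal_iff (by positivity)]
  refine le_antisymm ?_ ?_
  · refine le_of_forall_gt_imp_ge_of_dense fun s hs => ?_
    rcases eq_or_ne s ⊤ with rfl | hs_ne_top
    · exact le_top
    lift s to NNReal using hs_ne_top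
    have hs0 : 0 < s := by exact_mod_cast (zero_le.trans_lt hs)
    have hs' : (s : ℝ≥0∞)⁻¹ < 1 + α := by
      rwa [ENNReal.inv_lt_iff_inv_lt, ← one_div]
    rcases lt_or_ge 1 s with h1 | h1
    · have := dimH_approxSet_le (l := l) (x₀ := x₀) (s := s) (A := 0) (by exact_mod_cast hs0)
        (by simpa using h1) (Eventually.of_forall fun n => by simp)
      simpa using this
    · -- an `A < α` with `s⁻¹ < 1 + A`
      obtain ⟨e, he1, he2⟩ := exists_between hs'
      have he_ne_top : e ≠ ⊤ := he2.ne_top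
      lift e to NNReal using he_ne_top
      have hse : (s : ℝ)⁻¹ < e := by
        have : s⁻¹ < e := by
          rw [← ENNReal.coe_inv hs0.ne'] at he1
          exact_mod_cast he1
        exact_mod_cast this
      have hs1 : (s : ℝ) ≤ 1 := by exact_mod_cast h1
      have hsr : (0 : ℝ) < s := by exact_mod_cast hs0
      have he : (1 : ℝ) < e := ((one_le_inv₀ hsr).2 hs1).trans_lt hse
      have hA : ENNReal.ofReal ((e : ℝ) - 1) < α := by
        rw [← ENNReal.add_lt_add_iff_left ENNReal.one_ne_top, ← ENNReal.ofReal_one,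
          ← ENNReal.ofReal_add zero_le_one (by linarith)]
        simpa using he2
      have hev := eventually_lt_of_lt_liminf (hα ▸ hA)
      have := dimH_approxSet_le (l := l) (x₀ := x₀) (s := s) (A := (e : ℝ) - 1) hsr ?_ ?_
      · simpa using this
      · rw [add_sub_cancel]
        rwa [inv_lt_iff_one_lt_mul₀' hsr] at hse
      · filter_upwards [hev, eventually_gt_atTop 0] with n h2 h3
        exact (hdiv n _ h3 (by linarith)).1 h2.le
  · refine le_of_forall_lt_imp_le_of_dense fun s hs => ?_
    rcases eq_or_ne s 0 with rfl | hs0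
    · exact zero_le
    have hs_ne_top : s ≠ ⊤ := hs.ne_top
    lift s to NNReal using hs_ne_top
    have hs0' : 0 < s := pos_iff_ne_zero.2 (by exact_mod_cast hs0)
    have hsr : (0 : ℝ) < s := by exact_mod_cast hs0'
    have hs' : 1 + α < (s : ℝ≥0∞)⁻¹ := by
      rwa [ENNReal.lt_inv_iff_lt_inv, ← one_div]
    -- a `B > α` with `1 + B < s⁻¹`
    obtain ⟨e, he1, he2⟩ := exists_between hs'
    have he_ne_top : e ≠ ⊤ := he2.ne_top
    lift e to NNReal using he_ne_top
    have hse : (e : ℝ) < (s : ℝ)⁻¹ := by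
      have : e < s⁻¹ := by
        rw [← ENNReal.coe_inv hs0'.ne'] at he2
        exact_mod_cast he2
      exact_mod_cast this
    have he : (1 : ℝ) ≤ e := by
      have : (1 : ℝ≥0∞) ≤ e := le_self_add.trans he1.le
      exact_mod_cast this
    have hB : α < ENNReal.ofReal ((e : ℝ) - 1) := by
      rw [← ENNReal.add_lt_add_iff_left ENNReal.one_ne_top, ← ENNReal.ofReal_one,
        ← ENNReal.ofReal_add zero_le_one (by linarith)]
      simpa using he1
    have hfr := frequently_lt_of_liminf_lt (h := hα ▸ hB)
    have := le_dimH_approxSet (l := l) (s := s) (B := (e : ℝ) - 1) hx₀ hsr (by linarith) ?_ ?_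
    · simpa using this
    · rw [add_sub_cancel]
      rwa [← one_div, lt_div_iff₀' hsr] at hse
    · refine (hfr.and_eventually (eventually_gt_atTop 0)).mono fun n hn => ?_
      by_contra hlt
      exact absurd ((hdiv n _ hn.2 (by linarith)).2 (not_le.1 hlt).le) (not_le.2 hn.1)
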